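/- **Conventions.** Let $\varphi$ be the rotation of $\mathbb R^2$ through $-\pi/2$ about the origin. Let $R_0=[-1,1]^2$ be decorated as follows: its four unit squares (quadrants) carry four distinct colours (black, dark grey, light grey, white, in any fixed assignment), and each unit square carries an arrow that points diagonally away from the centre of $R_0$. Define stacks of decorated, overlapping squares by $P_0=\{R_0\}$ and $$P_n=\{P_{n-1}+(-2^{n-1},0),\ \varphi P_{n-1}+(0,2^{n-1}),\ \varphi^2P_{n-1}+(2^{n-1},0),\ \varphi^3P_{n-1}+(0,-2^{n-1})\},$$ where all squares of an earlier set in this list lie above all squares of a later one, and squares within one set keep their above-below relation. Let $R_n$ be the patch of decorated unit squares $[k,k+1]\times[m,m+1]$ ($k,m\in\mathbb Z$) contained in at least one large square of $P_n$, each inheriting its colour and arrow from the topmost large square of $P_n$ that contains it. A *tiling* is a collection of labelled tiles (compact sets with nonempty interior, each with a label) that cover $\mathbb R^2$ and such that distinct tiles have disjoint interiors. Translations act on the tiles and leave the labels (colours and arrow directions) unchanged. A *period* of $\mathcal T$ is a vector $t$ with $\mathcal T+t=\mathcal T$; $\mathcal T$ is *periodic* if it has a period $t\neq 0$, and *nonperiodic*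 otherwise. Let $B_r$ be the open ball of radius $r$ about $0$, and let $B_r\cap\mathcal T=\{T\in\mathcal T : T\subset B_r\}$. For collections of tiles put $d(\mathcal T,\mathcal T')=\min\{\tilde d(\mathcal T,\mathcal T'),1/\sqrt2\}$, where $$\tilde d(\mathcal T,\mathcal T')=\inf\{\varepsilon>0 : \exists\, x,y\in B_\varepsilon,\ B_{1/\varepsilon}\cap(\mathcal T+x)=B_{1/\varepsilon}\cap(\mathcal T'+y)\}\qquad(\inf\emptyset=\infty).$$ The *hull* $\mathbb X(\mathcal T)$ is the set of all tilings that lie in the closure of $\{\mathcal T+t : t\in\mathbb R^2\}$ with respect to $d$. A tiling is *aperiodic* if its hull contains no periodic tiling. **Theorem 3.4.** Let $\mathcal A$ be the set of all decorated unit squares that belong to $R_n$ for all sufficiently large $n$. Then $\mathcal A$ is a tiling, and $d(R_n,\mathcal A)\to0$ as $n\to\infty$. All $\mathcal T\in\mathbb X(\mathcal A)$ are aperiodic (hence nonperiodic). In particular $\mathcal A$ is aperiodic (hence nonperiodic). -/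

import Mathlib

open Filter Topology

namespace InductiveRotation

/-- The Euclidean plane. -/
abbrev Plane := EuclideanSpace ℝ (Fin 2)

section Tilings

/-- A tile with an additional attribute: a pair of a subset of the plane and a label. -/
@[ext]
structure Tile (L : Type) where
  support : Set Plane
  label : L

variable {L : Type}

/-- The translate `Q + t` of a tile; the label is unchanged. -/
def Tile.translate (t : Plane) (Q : Tile L) : Tile L :=
  ⟨(fun p => p + t) '' Q.support, Q.label⟩

/-- The translate `T + t` of a collection of tiles. -/
def translateAll (t : Plane) (T : Set (Tile L)) : Set (Tile L) :=
  Tile.translate t '' T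

/-- A tiling of the plane: a collection of tiles (compact sets with nonempty interior, carrying
labels) that is a covering of the plane and a packing. -/
structure IsTiling (T : Set (Tile L)) : Prop where
  compact : ∀ Q ∈ T, IsCompact Q.support
  interior_nonempty : ∀ Q ∈ T, (interior Q.support).Nonempty
  covering : ⋃ Q ∈ T, Q.support = Set.univ
  packing : ∀ Q ∈ T, ∀ Q' ∈ T, Q ≠ Q' → interior Q.support ∩ interior Q'.support = ∅

/-- `t` is a period of `T`. -/
def IsPeriod (T : Set (Tile L)) (t : Plane) : Prop := translateAll t T = T

/-- `T` has a nontrivial period. -/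
def IsPeriodic (T : Set (Tile L)) : Prop := ∃ t : Plane, t ≠ 0 ∧ IsPeriod T t

/-- The only period of `T` is the trivial one. -/
def IsNonperiodic (T : Set (Tile L)) : Prop := ∀ t : Plane, IsPeriod T t → t = 0

/-- `T ∩ B_r`: the tiles of `T` that are contained in the open ball of radius `r` about `0`. -/
def inBall (r : ℝ) (T : Set (Tile L)) : Set (Tile L) :=
  {Q | Q ∈ T ∧ Q.support ⊆ Metric.ball (0 : Plane) r}

/-- The infimum of all `ε > 0` such that `T + x` and `T' + y` agree in the ball `B_{1/ε}` for some
`x, y ∈ B_ε` (with the value `∞` if there is no such `ε`). -/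
noncomputable def preDist (T T' : Set (Tile L)) : ENNReal :=
  ⨅ ε ∈ {ε : ℝ | 0 < ε ∧ ∃ x ∈ Metric.ball (0 : Plane) ε, ∃ y ∈ Metric.ball (0 : Plane) ε,
    inBall (1 / ε) (translateAll x T) = inBall (1 / ε) (translateAll y T')}, ENNReal.ofReal ε

/-- The distance of the local topology. -/
noncomputable def tilingDist (T T' : Set (Tile L)) : ENNReal :=
  min (preDist T T') (ENNReal.ofReal (1 / Real.sqrt 2))

/-- The hull of `T`: all tilings in the closure of the set of translates of `T`. -/
def hull (T : Set (Tile L)) : Set (Set (Tile L)) :=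
  {S | IsTiling S ∧ ∀ δ : ENNReal, 0 < δ → ∃ t : Plane, tilingDist S (translateAll t T) < δ}

/-- `T` is aperiodic if its hull does not contain any periodic tiling. -/
def IsAperiodic (T : Set (Tile L)) : Prop := ∀ S ∈ hull T, ¬ IsPeriodic S

end Tilings

section Arrowed

inductive Colour
  | black
  | darkGrey
  | lightGrey
  | white

/-- The attribute of a unit square: a colour, and an arrow that points along a diagonal to one of
the four corners. The corners, and likewise the quadrants of a large square, are numbered
clockwise: `0` is upper right, `1` is lower right, `2` is lower left, `3` is upper left. -/
@[ext]
structure Decoration where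
  colour : Colour
  arrow : Fin 4

/-- A large square `[a - 1, a + 1] × [b - 1, b + 1]` with centre `(a, b)`, obtained from the
decorated square about the origin by `turns` rotations through `-π/2` and a translation. -/
structure LargeSquare where
  centre : ℤ × ℤ
  turns : Fin 4

/-- The rotation `φ` through `-π/2` about the origin. -/
def LargeSquare.rotate (s : LargeSquare) : LargeSquare :=
  ⟨(s.centre.2, -s.centre.1), s.turns + 1⟩

def LargeSquare.shift (v : ℤ × ℤ) (s : LargeSquare) : LargeSquare :=
  ⟨s.centre + v, s.turns⟩

/-- The configurations `P_n` of overlapping large squares, listed from top to bottom. -/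
def stack : ℕ → List LargeSquare
  | 0 => [⟨(0, 0), 0⟩]
  | n + 1 =>
    (stack n).map (fun s => s.shift (-2 ^ n, 0)) ++
    (stack n).map (fun s => s.rotate.shift (0, 2 ^ n)) ++
    (stack n).map (fun s => s.rotate.rotate.shift (2 ^ n, 0)) ++
    (stack n).map (fun s => s.rotate.rotate.rotate.shift (0, -2 ^ n))

/-- The quadrant of the large square `s` that is the unit square `[k, k + 1] × [m, m + 1]`, where
`K = (k, m)`; `none` if that unit square is not contained in `s`. -/
def LargeSquare.quadrant (s : LargeSquare) (K : ℤ × ℤ) : Option (Fin 4) :=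
  if K = s.centre then some 0
  else if K = s.centre + (0, -1) then some 1
  else if K = s.centre + (-1, -1) then some 2
  else if K = s.centre + (-1, 0) then some 3
  else none

/-- The decoration that the large square `s` shows on the unit square at `K`. In the unrotated
square, quadrant `q` has colour `c q`; a rotation through `-π/2` moves it to quadrant `q + 1`.
The arrow always points away from the centre of the large square. -/
def LargeSquare.decoration (c : Fin 4 → Colour) (s : LargeSquare) (K : ℤ × ℤ) :
    Option Decoration :=
  (s.quadrant K).map fun q => ⟨c (q - s.turns), q⟩

/-- What one sees of `P_n` from above on the unit square at `K`: the decoration inherited from the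
topmost large square that contains it. -/
def view (c : Fin 4 → Colour) (n : ℕ) (K : ℤ × ℤ) : Option Decoration :=
  (stack n).findSome? fun s => s.decoration c K

/-- The unit square `[k, k + 1] × [m, m + 1]`, where `K = (k, m)`. -/
def unitSquare (K : ℤ × ℤ) : Set Plane :=
  {p | p 0 ∈ Set.Icc (K.1 : ℝ) (K.1 + 1) ∧ p 1 ∈ Set.Icc (K.2 : ℝ) (K.2 + 1)}

/-- The patch `R_n` of decorated unit squares visible from above. -/
def patch (c : Fin 4 → Colour) (n : ℕ) : Set (Tile Decoration) :=
  {Q | ∃ (K : ℤ × ℤ) (l : Decoration), view c n K = some l ∧ Q = ⟨unitSquare K, l⟩}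

/-- The arrowed tiling: the limit of the patches `R_n`, that is, the collection of all tiles that
belong to `R_n` for all sufficiently large `n`. -/
def arrowedTiling (c : Fin 4 → Colour) : Set (Tile Decoration) :=
  {Q | ∀ᶠ n in atTop, Q ∈ patch c n}

end Arrowed

end InductiveRotation

open InductiveRotation

namespace InductiveRotation

/-! Turned by 45 degrees, `P_n` becomes a square grid. The large squares are indexed by `(i, j)`
with `0 ≤ i, j < 2 ^ n`, the centre is `(i + j + 1 - 2 ^ n, i - j)`, and the turns are read off from
the parities of `i` and `j`. Away from the boundary a unit square is the overlap of exactly two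
large squares, whose indices are neighbours, so the view is known once each pair of neighbours is
ordered.

The recursion splits a block turned `g` times into four half-size blocks turned `g + q`, smaller `q`
on top. Neighbours `x`, `x + 1` on a line `y` with `x + 1 = 2 ^ t * (2 * a + 1)` are separated at
level `t`. Their order depends only on `a` mod 2 and on `b = ⌊y / 2 ^ t⌋` mod 4, through `TopFst` or
`TopSnd` (`cross_table`, `pairwise_indices`). Centring the grid adds a power `2 ^ N` to both
coordinates. This leaves the residues unchanged for large `N`, and the line `x + 1 = 0` is settled
separately, so every unit square stabilises (`exists_eventualOrder`). This gives the tiling and the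
convergence.

For aperiodicity, a vector is excluded as a period by tiles found in every ball of a fixed radius
(`UniformlyRefutes`). This property passes to all elements of the hull. In `𝒜` a nonzero integer
vector either changes the diagonal of the arrows, or is an index shift `2 ^ k * (δ', ε')` with `δ'`,
`ε'` not both even. For `k = 0` the colours detect it, because they record index parities. For `k ≥
1` the arrows at level `k - 1` detect it, because `TopFst` has no such period. -/

/-! ### Index coordinates for the stack -/

/-- Positions of the four directions left, up, right, down in the coordinates
`(x + y, x - y)`, recorded by signs. -/
def bits : Fin 4 → ℤ × ℤ := ![(0, 0), (1, 0), (1, 1), (0, 1)]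

/-- The direction with the given parities. -/
def dirOf (i j : ℤ) : Fin 4 :=
  if i % 2 = 0 then (if j % 2 = 0 then 0 else 3) else (if j % 2 = 0 then 1 else 2)

/-- The indices of the large squares of the `g`-fold rotated stack, from top to bottom. -/
def indices : ℕ → Fin 4 → List (ℤ × ℤ)
  | 0, g => [bits g]
  | n + 1, g => ([0, 1, 2, 3] : List (Fin 4)).flatMap fun q =>
      (indices n (g + q)).map fun X => (X.1 + 2 ^ (n + 1) * (bits g).1, X.2 + 2 ^ (n + 1) * (bits g).2)

/-- The large square with a given index in the `g`-fold rotated stack. -/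
def toSquare (n : ℕ) (g : Fin 4) (X : ℤ × ℤ) : LargeSquare :=
  ⟨((X.1 - 2 ^ n * (bits g).1) + (X.2 - 2 ^ n * (bits g).2) + 1 - 2 ^ n,
    (X.1 - 2 ^ n * (bits g).1) - (X.2 - 2 ^ n * (bits g).2)), dirOf X.1 X.2⟩

/-- The rotation through `-g * π / 2`. -/
def rotateBy : Fin 4 → LargeSquare → LargeSquare :=
  ![id, LargeSquare.rotate, fun s => s.rotate.rotate, fun s => s.rotate.rotate.rotate]

/-- Each block offset is subtracted again by `toSquare`, so `g` and `h` are arbitrary here. Turns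
survive because the offset `2 ^ (n + 1)` is even. -/
lemma toSquare_succ (n : ℕ) (g h : Fin 4) (X : ℤ × ℤ) :
    toSquare (n + 1) g (X.1 + 2 ^ (n + 1) * (bits g).1, X.2 + 2 ^ (n + 1) * (bits g).2) =
      (toSquare n h X).shift
        (2 ^ n * ((bits h).1 + (bits h).2 - 1), 2 ^ n * ((bits h).1 - (bits h).2)) := by
  have e : (2 : ℤ) ^ (n + 1) = 2 * 2 ^ n := by ring
  simp only [toSquare, LargeSquare.shift, LargeSquare.mk.injEq, Prod.mk_add_mk, Prod.mk.injEq]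
  refine ⟨⟨by ring, by ring⟩, ?_⟩
  have h1 : (X.1 + 2 ^ (n + 1) * (bits g).1) % 2 = X.1 % 2 := by
    rw [e, mul_assoc]; omega
  have h2 : (X.2 + 2 ^ (n + 1) * (bits g).2) % 2 = X.2 % 2 := by
    rw [e, mul_assoc]; omega
  simp only [dirOf, h1, h2]

/-- The four displacements form one orbit of the rotation, so turning the `q`-th copy `g` times puts
it where copy `g + q` belongs. -/
lemma rotateBy_shift (g q : Fin 4) (N : ℤ) (s : LargeSquare) :
    rotateBy g ((rotateBy q s).shift
      (N * ((bits q).1 + (bits q).2 - 1), N * ((bits q).1 - (bits q).2))) =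
      (rotateBy (g + q) s).shift
      (N * ((bits (g + q)).1 + (bits (g + q)).2 - 1),
        N * ((bits (g + q)).1 - (bits (g + q)).2)) := by
  obtain ⟨⟨x, y⟩, r⟩ := s
  fin_cases g <;> fin_cases q <;>
    simp [rotateBy, bits, LargeSquare.shift, LargeSquare.rotate, Fin.ext_iff, Fin.val_add] <;>
    grind

lemma stack_succ (n : ℕ) : stack (n + 1) = ([0, 1, 2, 3] : List (Fin 4)).flatMap fun q =>
    (stack n).map fun s => (rotateBy q s).shift
      (2 ^ n * ((bits q).1 + (bits q).2 - 1), 2 ^ n * ((bits q).1 - (bits q).2)) := by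
  simp [stack, rotateBy, bits]

lemma map_rotateBy_stack (n : ℕ) (g : Fin 4) :
    (stack n).map (rotateBy g) = (indices n g).map (toSquare n g) := by
  induction n generalizing g with
  | zero =>
    fin_cases g <;> simp [stack, indices, rotateBy, toSquare, bits, dirOf, LargeSquare.rotate]
  | succ n ih =>
    rw [stack_succ, indices, List.map_flatMap, List.map_flatMap]
    refine congrArg (fun f => List.flatMap f _) (funext fun q => ?_)
    have h := congrArg (List.map (LargeSquare.shift
      (2 ^ n * ((bits (g + q)).1 + (bits (g + q)).2 - 1),
        2 ^ n * ((bits (g + q)).1 - (bits (g + q)).2)))) (ih (g + q))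
    simp only [List.map_map] at h ⊢
    convert h using 2
    · funext s
      exact rotateBy_shift g q _ s
    · funext X
      exact toSquare_succ n g (g + q) X

lemma stack_eq (n : ℕ) : stack n = (indices n 0).map (toSquare n 0) := by
  rw [← map_rotateBy_stack]
  simp [rotateBy]

/-! ### Dyadic blocks -/

/-- `x` lies in the dyadic interval `[2 ^ n * p, 2 ^ n * (p + 1))`. -/
def InBlock (n : ℕ) (p x : ℤ) : Prop := 2 ^ n * p ≤ x ∧ x < 2 ^ n * p + 2 ^ n

lemma InBlock.unique {n : ℕ} {p q x : ℤ} (hp : InBlock n p x) (hq : InBlock n q x) : p = q := by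
  obtain ⟨h1, h2⟩ := hp
  obtain ⟨h3, h4⟩ := hq
  have N : (0 : ℤ) < 2 ^ n := by positivity
  have a1 : p < q + 1 := lt_of_mul_lt_mul_left (by linarith : (2 : ℤ) ^ n * p < 2 ^ n * (q + 1)) N.le
  have a2 : q < p + 1 := lt_of_mul_lt_mul_left (by linarith : (2 : ℤ) ^ n * q < 2 ^ n * (p + 1)) N.le
  omega

lemma InBlock.shift {n : ℕ} {p x : ℤ} (h : InBlock n p x) (g : ℤ) :
    InBlock n (2 * g + p) (x + 2 ^ (n + 1) * g) := by
  obtain ⟨h1, h2⟩ := h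
  constructor <;> rw [pow_succ] <;> linarith

lemma InBlock.coarsen {n : ℕ} {g b x : ℤ} (h : InBlock n (2 * g + b) x) (h0 : 0 ≤ b)
    (h1 : b ≤ 1) : InBlock (n + 1) g x := by
  obtain ⟨h2, h3⟩ := h
  have N : (0 : ℤ) < 2 ^ n := by positivity
  constructor <;> rw [pow_succ] <;> nlinarith

lemma InBlock.refine {n : ℕ} {g x : ℤ} (h : InBlock (n + 1) g x) :
    ∃ b : ℤ, (b = 0 ∨ b = 1) ∧ InBlock n b (x - 2 ^ (n + 1) * g) := by
  obtain ⟨h2, h3⟩ := h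
  simp only [InBlock]
  rw [pow_succ] at *
  by_cases h : x - 2 ^ n * 2 * g < 2 ^ n
  · exact ⟨0, .inl rfl, by linarith, by linarith⟩
  · exact ⟨1, .inr rfl, by linarith, by linarith⟩

lemma bits_bound (g : Fin 4) :
    (0 ≤ (bits g).1 ∧ (bits g).1 ≤ 1) ∧ 0 ≤ (bits g).2 ∧ (bits g).2 ≤ 1 := by
  fin_cases g <;> simp [bits]

lemma mem_indices_succ {n : ℕ} {g : Fin 4} {X : ℤ × ℤ} :
    X ∈ indices (n + 1) g ↔ ∃ h, ∃ Y ∈ indices n h,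
      X = (Y.1 + 2 ^ (n + 1) * (bits g).1, Y.2 + 2 ^ (n + 1) * (bits g).2) := by
  rw [indices, List.mem_flatMap]
  constructor
  · rintro ⟨q, -, hq⟩
    obtain ⟨Y, hY, rfl⟩ := List.mem_map.1 hq
    exact ⟨_, Y, hY, rfl⟩
  · rintro ⟨h, Y, hY, rfl⟩
    refine ⟨h - g, ?_, List.mem_map.2 ⟨Y, by simpa using hY, rfl⟩⟩
    generalize h - g = q
    revert q
    decide

lemma mem_indices {n : ℕ} {g : Fin 4} {X : ℤ × ℤ} :
    X ∈ indices n g ↔ InBlock n (bits g).1 X.1 ∧ InBlock n (bits g).2 X.2 := by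
  induction n generalizing g X with
  | zero =>
    simp only [indices, List.mem_singleton, InBlock, Prod.ext_iff]
    constructor
    · rintro ⟨h1, h2⟩
      constructor <;> constructor <;> omega
    · rintro ⟨⟨h1, h2⟩, h3, h4⟩
      constructor <;> omega
  | succ n ih =>
    rw [mem_indices_succ]
    constructor
    · rintro ⟨h, Y, hY, rfl⟩
      have hb := bits_bound h
      have := ih.1 hY
      exact ⟨(this.1.shift _).coarsen hb.1.1 hb.1.2, (this.2.shift _).coarsen hb.2.1 hb.2.2⟩
    · rintro ⟨h1, h2⟩
      obtain ⟨b1, hb1, k1⟩ := h1.refine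
      obtain ⟨b2, hb2, k2⟩ := h2.refine
      obtain ⟨h, hh⟩ : ∃ h, bits h = (b1, b2) := by
        rcases hb1 with rfl | rfl <;> rcases hb2 with rfl | rfl
        exacts [⟨0, rfl⟩, ⟨3, rfl⟩, ⟨1, rfl⟩, ⟨2, rfl⟩]
      refine ⟨h, (X.1 - 2 ^ (n + 1) * (bits g).1, X.2 - 2 ^ (n + 1) * (bits g).2),
        ih.2 ?_, by simp⟩
      rw [hh]
      exact ⟨k1, k2⟩

/-! ### The order of neighbouring squares -/

/-- For horizontal neighbours in index coordinates: the right one is the upper one. -/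
def TopFst (a b : ℤ) : Prop := b % 4 = 1 ∨ (b % 4 ≠ 2 ∧ a % 2 = 1)

/-- For vertical neighbours in index coordinates: the higher one is the upper one. -/
def TopSnd (a b : ℤ) : Prop := b % 4 = 2 ∨ (b % 4 ≠ 1 ∧ a % 2 = 1)

instance (a b : ℤ) : Decidable (TopFst a b) := by unfold TopFst; infer_instance
instance (a b : ℤ) : Decidable (TopSnd a b) := by unfold TopSnd; infer_instance

/-- `P a b` depends only on `a` modulo `2` and on `b` modulo `4`. -/
def DyadicPeriodic (P : ℤ → ℤ → Prop) : Prop :=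
  ∀ a b k l : ℤ, P (a + 2 * k) (b + 4 * l) ↔ P a b

lemma dyadicPeriodic_topFst : DyadicPeriodic TopFst := by
  intro a b k l
  unfold TopFst
  omega

lemma dyadicPeriodic_topSnd : DyadicPeriodic TopSnd := by
  intro a b k l
  unfold TopSnd
  omega

/-- `(x, y)` is above `(x', y')`, as far as these are neighbours on the same line `y = y'` that
are separated at a dyadic level below `n`. -/
def AboveOnLine (P : ℤ → ℤ → Prop) (n : ℕ) (x y x' y' : ℤ) : Prop :=
  ∀ t < n, ∀ a b r : ℤ, 0 ≤ r → r < 2 ^ t → y = 2 ^ t * b + r → y' = y →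
    (x + 1 = 2 ^ t * (2 * a + 1) → x' = x + 1 → ¬ P a b) ∧
    (x' + 1 = 2 ^ t * (2 * a + 1) → x = x' + 1 → P a b)

/-- For `t < n` the number `2 ^ (n + 1)` is a multiple of `4 * 2 ^ t`, so the shift changes `a` by
an even number and `b` by a multiple of 4. -/
lemma AboveOnLine.shift {P : ℤ → ℤ → Prop} (hP : DyadicPeriodic P) {n : ℕ} {x y x' y' : ℤ}
    (h : AboveOnLine P n x y x' y') (α β : ℤ) :
    AboveOnLine P n (x + 2 ^ (n + 1) * α) (y + 2 ^ (n + 1) * β)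
      (x' + 2 ^ (n + 1) * α) (y' + 2 ^ (n + 1) * β) := by
  intro t ht a b r h0 hr hy hy'
  obtain ⟨s, rfl⟩ := Nat.exists_eq_add_of_lt ht
  have e : (2 : ℤ) ^ (t + s + 1 + 1) = 2 ^ t * (4 * 2 ^ s) := by ring
  rw [e] at hy hy' ⊢
  have := h t ht (a - 2 * (2 ^ s * α)) (b - 4 * (2 ^ s * β)) r h0 hr (by linarith) (by linarith)
  have hp := hP (a - 2 * (2 ^ s * α)) (b - 4 * (2 ^ s * β)) (2 ^ s * α) (2 ^ s * β)
  simp only [sub_add_cancel] at hp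
  rw [hp]
  exact ⟨fun h1 h2 => this.1 (by linarith) (by linarith),
    fun h1 h2 => this.2 (by linarith) (by linarith)⟩

lemma not_inBlock_consecutive {n : ℕ} {p x m : ℤ} (h : InBlock n p x) (h' : InBlock n p (x + 1))
    (hx : x + 1 = 2 ^ n * m) : False := by
  obtain ⟨h1, -⟩ := h
  obtain ⟨-, h2⟩ := h'
  have N : (0 : ℤ) < 2 ^ n := by positivity
  rw [hx] at h2
  have a1 : p < m := lt_of_mul_lt_mul_left (by linarith : (2 : ℤ) ^ n * p < 2 ^ n * m) N.le
  have a2 : m < p + 1 := lt_of_mul_lt_mul_left (by linarith : (2 : ℤ) ^ n * m < 2 ^ n * (p + 1)) N.le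
  omega

/-- The only new level is `t = n`, where the larger neighbour is a multiple of `2 ^ n`. This cannot
happen inside one block of that size. -/
lemma AboveOnLine.succ {P : ℤ → ℤ → Prop} {n : ℕ} {x y x' y' p : ℤ}
    (h : AboveOnLine P n x y x' y') (hx : InBlock n p x) (hx' : InBlock n p x') :
    AboveOnLine P (n + 1) x y x' y' := by
  intro t ht a b r h0 hr hy hy'
  rcases Nat.lt_succ_iff_lt_or_eq.1 ht with ht | rfl
  · exact h t ht a b r h0 hr hy hy'
  · refine ⟨fun h1 h2 => ?_, fun h1 h2 => ?_⟩
    · exact (not_inBlock_consecutive hx (h2 ▸ hx') h1).elim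
    · exact (not_inBlock_consecutive hx' (h2 ▸ hx) h1).elim

/-- Neighbours in different blocks meet at `x + 1 = 2 ^ n * (p + 1)`. Since `p + 1` is odd, `2 ^ n`
is the exact power of 2 in `x + 1`. -/
lemma crossing {n t : ℕ} {p p' x a : ℤ} (ht : t < n + 1) (hx : InBlock n p x)
    (hx' : InBlock n p' (x + 1)) (hne : p ≠ p') (hodd : p' = p + 1 → p' % 2 = 1)
    (h : x + 1 = 2 ^ t * (2 * a + 1)) : p' = p + 1 ∧ t = n ∧ a = p / 2 := by
  obtain ⟨h1, h2⟩ := hx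
  obtain ⟨h3, h4⟩ := hx'
  have N : (0 : ℤ) < 2 ^ n := by positivity
  have a1 : p' < p + 2 := lt_of_mul_lt_mul_left
    (by linarith : (2 : ℤ) ^ n * p' < 2 ^ n * (p + 2)) N.le
  have a2 : p < p' + 1 := lt_of_mul_lt_mul_left
    (by linarith : (2 : ℤ) ^ n * p < 2 ^ n * (p' + 1)) N.le
  obtain rfl : p' = p + 1 := by omega
  have e : x + 1 = 2 ^ n * (p + 1) := by linarith
  have ho := hodd rfl
  obtain ⟨s, rfl⟩ := Nat.exists_eq_add_of_le (Nat.lt_succ_iff.1 ht)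
  rw [h, pow_add, mul_assoc] at e
  have e2 := mul_left_cancel₀ (by positivity) e
  rcases s with _ | s
  · refine ⟨rfl, rfl, ?_⟩
    rw [pow_zero, one_mul] at e2
    omega
  · rw [pow_succ', mul_assoc] at e2
    omega

lemma AboveOnLine.cross {P : ℤ → ℤ → Prop} {n : ℕ} {x y x' y' p q p' q' : ℤ}
    (hx : InBlock n p x) (hy : InBlock n q y) (hx' : InBlock n p' x') (hy' : InBlock n q' y')
    (hne : q = q' → p ≠ p')
    (h1 : q = q' → p' = p + 1 → p' % 2 = 1 ∧ ¬ P (p / 2) q)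
    (h2 : q = q' → p = p' + 1 → p % 2 = 1 ∧ P (p' / 2) q) :
    AboveOnLine P (n + 1) x y x' y' := by
  intro t ht a b r h0 hr e e'
  have hq : q = q' := hy.unique (e' ▸ hy')
  refine ⟨fun h3 h4 => ?_, fun h3 h4 => ?_⟩
  · subst h4
    obtain ⟨k1, rfl, rfl⟩ := crossing ht hx hx' (hne hq) (fun h => (h1 hq h).1) h3
    obtain rfl : b = q := InBlock.unique (n := t) ⟨by linarith, by linarith⟩ hy
    exact (h1 hq k1).2
  · subst h4
    obtain ⟨k1, rfl, rfl⟩ := crossing ht hx' hx (hne hq).symm (fun h => (h2 hq h).1) h3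
    obtain rfl : b = q := InBlock.unique (n := t) ⟨by linarith, by linarith⟩ hy
    exact (h2 hq k1).2

/-- The index `X` comes before `Y` in the stack, as far as these are different neighbours. -/
def Above (n : ℕ) (X Y : ℤ × ℤ) : Prop :=
  AboveOnLine TopFst n X.1 X.2 Y.1 Y.2 ∧ AboveOnLine TopSnd n X.2 X.1 Y.2 Y.1

/-- At the level where a block splits, `a` is the first bit of `g`, and `b` is composed of the
second bit of `g` and that of the sub-block. The rules have to agree with the list order of the four
sub-blocks for each number of turns, which is a finite check. -/
lemma cross_table : ∀ g q q' : Fin 4, q < q' →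
    ((bits (g + q)).2 = (bits (g + q')).2 → (bits (g + q)).1 ≠ (bits (g + q')).1) ∧
    ((bits (g + q)).2 = (bits (g + q')).2 → (bits (g + q')).1 = (bits (g + q)).1 + 1 →
      (bits (g + q')).1 % 2 = 1 ∧ ¬ TopFst (bits g).1 (2 * (bits g).2 + (bits (g + q)).2)) ∧
    ((bits (g + q)).2 = (bits (g + q')).2 → (bits (g + q)).1 = (bits (g + q')).1 + 1 →
      (bits (g + q)).1 % 2 = 1 ∧ TopFst (bits g).1 (2 * (bits g).2 + (bits (g + q)).2)) ∧
    ((bits (g + q)).1 = (bits (g + q')).1 → (bits (g + q')).2 = (bits (g + q)).2 + 1 →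
      (bits (g + q')).2 % 2 = 1 ∧ ¬ TopSnd (bits g).2 (2 * (bits g).1 + (bits (g + q)).1)) ∧
    ((bits (g + q)).1 = (bits (g + q')).1 → (bits (g + q)).2 = (bits (g + q')).2 + 1 →
      (bits (g + q)).2 % 2 = 1 ∧ TopSnd (bits g).2 (2 * (bits g).1 + (bits (g + q)).1)) := by
  decide

lemma above_cross {n : ℕ} {g q q' : Fin 4} (hq : q < q') {X Y : ℤ × ℤ}
    (hX : X ∈ indices n (g + q)) (hY : Y ∈ indices n (g + q')) :
    Above (n + 1) (X.1 + 2 ^ (n + 1) * (bits g).1, X.2 + 2 ^ (n + 1) * (bits g).2)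
      (Y.1 + 2 ^ (n + 1) * (bits g).1, Y.2 + 2 ^ (n + 1) * (bits g).2) := by
  rw [mem_indices] at hX hY
  obtain ⟨t0, t1, t2, t3, t4⟩ := cross_table g q q' hq
  obtain ⟨⟨b1, b2⟩, b3, b4⟩ := bits_bound (g + q)
  obtain ⟨⟨c1, c2⟩, c3, c4⟩ := bits_bound (g + q')
  -- A sub-block with a right or upper neighbour in the same block has bit 0 in that direction, so
  -- halving recovers the bit of `g`.
  have d1 : (2 * (bits g).1 + (bits (g + q)).1) / 2 = (bits g).1 ∨ (bits (g + q)).1 = 1 := by omega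
  have d2 : (2 * (bits g).1 + (bits (g + q')).1) / 2 = (bits g).1 ∨ (bits (g + q')).1 = 1 := by
    omega
  have d3 : (2 * (bits g).2 + (bits (g + q)).2) / 2 = (bits g).2 ∨ (bits (g + q)).2 = 1 := by omega
  have d4 : (2 * (bits g).2 + (bits (g + q')).2) / 2 = (bits g).2 ∨ (bits (g + q')).2 = 1 := by
    omega
  refine ⟨AboveOnLine.cross (hX.1.shift _) (hX.2.shift _) (hY.1.shift _) (hY.2.shift _) ?_ ?_ ?_,
    AboveOnLine.cross (hX.2.shift _) (hX.1.shift _) (hY.2.shift _) (hY.1.shift _) ?_ ?_ ?_⟩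
  · intro h; have := t0 (by omega); omega
  · intro h h'
    have := t1 (by omega) (by omega)
    rw [d1.resolve_right (by omega)]
    exact ⟨by omega, this.2⟩
  · intro h h'
    have := t2 (by omega) (by omega)
    rw [d2.resolve_right (by omega)]
    exact ⟨by omega, this.2⟩
  · intro h h'; have := t0 (by omega); omega
  · intro h h'
    have := t3 (by omega) (by omega)
    rw [d3.resolve_right (by omega)]
    exact ⟨by omega, this.2⟩
  · intro h h'
    have := t4 (by omega) (by omega)
    rw [d4.resolve_right (by omega)]
    exact ⟨by omega, this.2⟩

lemma pairwise_indices (n : ℕ) (g : Fin 4) : (indices n g).Pairwise (Above n) := by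
  induction n generalizing g with
  | zero => simp [indices]
  | succ n ih =>
    rw [indices, List.pairwise_flatMap]
    constructor
    · intro q _
      rw [List.pairwise_map]
      refine (ih (g + q)).imp_of_mem fun {X Y} hX hY h => ?_
      rw [mem_indices] at hX hY
      exact ⟨(h.1.shift dyadicPeriodic_topFst _ _).succ (hX.1.shift _) (hY.1.shift _),
        (h.2.shift dyadicPeriodic_topSnd _ _).succ (hX.2.shift _) (hY.2.shift _)⟩
    · have h : ([0, 1, 2, 3] : List (Fin 4)).Pairwise (· < ·) := by decide
      refine h.imp fun {q q'} hq X hX Y hY => ?_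
      obtain ⟨X', hX', rfl⟩ := List.mem_map.1 hX
      obtain ⟨Y', hY', rfl⟩ := List.mem_map.1 hY
      exact above_cross hq hX' hY'

/-! ### The topmost square over a unit square -/

/-- `R` need only be a consequence of list order: if `R y x` fails, `y` cannot precede `x`. This
suits `Above`, which is vacuous for squares that are not neighbours. -/
lemma findSome?_eq_of_pairwise {α β : Type*} {R : α → α → Prop} {f : α → Option β} {L : List α}
    (hL : L.Pairwise R) {x : α} {l : β} (hx : x ∈ L) (hl : f x = some l)
    (h : ∀ y ∈ L, f y ≠ none → y = x ∨ ¬ R y x) : L.findSome? f = some l := by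
  induction L with
  | nil => simp at hx
  | cons y L ih =>
    rw [List.pairwise_cons] at hL
    rw [List.findSome?_cons]
    rcases List.mem_cons.1 hx with rfl | hx
    · rw [hl]
    · by_cases hy : f y = none
      · rw [hy]
        exact ih hL.2 hx fun z hz => h z (List.mem_cons_of_mem _ hz)
      · rcases h y List.mem_cons_self hy with rfl | h'
        · rw [hl]
        · exact (h' (hL.1 x hx)).elim

/-- The decoration of quadrant `q` of a large square with turns given by `i`, `j`. -/
def shown (c : Fin 4 → Colour) (q : Fin 4) (i j : ℤ) : Decoration := ⟨c (q - dirOf i j), q⟩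

lemma dirOf_add (i j k l : ℤ) : dirOf (i + 2 * k) (j + 2 * l) = dirOf i j := by
  have h1 : (i + 2 * k) % 2 = i % 2 := by omega
  have h2 : (j + 2 * l) % 2 = j % 2 := by omega
  simp only [dirOf, h1, h2]

lemma decoration_eq (c : Fin 4 → Colour) (n : ℕ) (X K : ℤ × ℤ) :
    (toSquare n 0 X).decoration c K =
      if K = (X.1 + X.2 + 1 - 2 ^ n, X.1 - X.2) then some (shown c 0 X.1 X.2)
      else if K = (X.1 + X.2 + 1 - 2 ^ n, X.1 - X.2 - 1) then some (shown c 1 X.1 X.2)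
      else if K = (X.1 + X.2 - 2 ^ n, X.1 - X.2 - 1) then some (shown c 2 X.1 X.2)
      else if K = (X.1 + X.2 - 2 ^ n, X.1 - X.2) then some (shown c 3 X.1 X.2)
      else none := by
  have e1 : X.1 + X.2 + 1 - 2 ^ n + -1 = X.1 + X.2 - 2 ^ n := by ring
  have e2 : X.1 - X.2 + -1 = X.1 - X.2 - 1 := by ring
  simp only [LargeSquare.decoration, LargeSquare.quadrant, toSquare, bits, Matrix.cons_val_zero,
    mul_zero, sub_zero, Prod.mk_add_mk, add_zero, e1, e2]
  split_ifs <;> simp [shown]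

lemma view_eq (c : Fin 4 → Colour) (n : ℕ) (K : ℤ × ℤ) {X : ℤ × ℤ} {l : Decoration}
    (hX : X ∈ indices n 0) (hl : (toSquare n 0 X).decoration c K = some l)
    (h : ∀ Y ∈ indices n 0, (toSquare n 0 Y).decoration c K ≠ none → Y = X ∨ ¬ Above n Y X) :
    view c n K = some l := by
  rw [view, stack_eq, List.findSome?_map]
  exact findSome?_eq_of_pairwise (pairwise_indices n 0) hX hl h

lemma mem_indices_zero {n : ℕ} {X : ℤ × ℤ} :
    X ∈ indices n 0 ↔ (0 ≤ X.1 ∧ X.1 < 2 ^ n) ∧ 0 ≤ X.2 ∧ X.2 < 2 ^ n := by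
  simp [mem_indices, InBlock, bits]

/-- The unit square is quadrant 0 of index `(i, j)` and quadrant 2 of `(i + 1, j)`, and no other
large square contains it. -/
lemma view_fst (c : Fin 4 → Colour) {n : ℕ} {i j a b r : ℤ} {t : ℕ} (hi : 0 ≤ i)
    (hi' : i + 1 < 2 ^ n) (hj : 0 ≤ j) (hj' : j < 2 ^ n) (ht : t < n)
    (ha : i + 1 = 2 ^ t * (2 * a + 1)) (hb : j = 2 ^ t * b + r) (hr : 0 ≤ r) (hr' : r < 2 ^ t) :
    view c n (i + j + 1 - 2 ^ n, i - j) =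
      some (if TopFst a b then shown c 2 (i + 1) j else shown c 0 i j) := by
  split_ifs with h
  · refine view_eq c n _ (X := (i + 1, j)) (mem_indices_zero.2 ⟨⟨by omega, hi'⟩, hj, hj'⟩) ?_ ?_
    · rw [decoration_eq]
      grind
    · rintro ⟨x, y⟩ - hY
      rw [decoration_eq] at hY
      have : (x = i ∧ y = j) ∨ (x = i + 1 ∧ y = j) := by grind
      rcases this with ⟨rfl, rfl⟩ | ⟨rfl, rfl⟩
      · exact .inr fun hA => (hA.1 t ht a b r hr hr' hb rfl).1 ha rfl h
      · exact .inl rfl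
  · refine view_eq c n _ (X := (i, j)) (mem_indices_zero.2 ⟨⟨hi, by omega⟩, hj, hj'⟩) ?_ ?_
    · rw [decoration_eq]
      grind
    · rintro ⟨x, y⟩ - hY
      rw [decoration_eq] at hY
      have : (x = i ∧ y = j) ∨ (x = i + 1 ∧ y = j) := by grind
      rcases this with ⟨rfl, rfl⟩ | ⟨rfl, rfl⟩
      · exact .inl rfl
      · exact .inr fun hA => h ((hA.1 t ht a b r hr hr' hb rfl).2 ha rfl)

lemma view_snd (c : Fin 4 → Colour) {n : ℕ} {i j a b r : ℤ} {t : ℕ} (hi : 0 ≤ i)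
    (hi' : i < 2 ^ n) (hj : 0 ≤ j) (hj' : j + 1 < 2 ^ n) (ht : t < n)
    (ha : j + 1 = 2 ^ t * (2 * a + 1)) (hb : i = 2 ^ t * b + r) (hr : 0 ≤ r) (hr' : r < 2 ^ t) :
    view c n (i + j + 1 - 2 ^ n, i - j - 1) =
      some (if TopSnd a b then shown c 3 i (j + 1) else shown c 1 i j) := by
  split_ifs with h
  · refine view_eq c n _ (X := (i, j + 1)) (mem_indices_zero.2 ⟨⟨hi, hi'⟩, by omega, hj'⟩) ?_ ?_
    · rw [decoration_eq]
      grind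
    · rintro ⟨x, y⟩ - hY
      rw [decoration_eq] at hY
      have : (x = i ∧ y = j) ∨ (x = i ∧ y = j + 1) := by grind
      rcases this with ⟨rfl, rfl⟩ | ⟨rfl, rfl⟩
      · exact .inr fun hA => (hA.2 t ht a b r hr hr' hb rfl).1 ha rfl h
      · exact .inl rfl
  · refine view_eq c n _ (X := (i, j)) (mem_indices_zero.2 ⟨⟨hi, hi'⟩, hj, by omega⟩) ?_ ?_
    · rw [decoration_eq]
      grind
    · rintro ⟨x, y⟩ - hY
      rw [decoration_eq] at hY
      have : (x = i ∧ y = j) ∨ (x = i ∧ y = j + 1) := by grind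
      rcases this with ⟨rfl, rfl⟩ | ⟨rfl, rfl⟩
      · exact .inl rfl
      · exact .inr fun hA => h ((hA.2 t ht a b r hr hr' hb rfl).2 ha rfl)

/-! ### Stabilisation of the view -/

/-- For all large `N`, the order of the neighbours at signed coordinates `(x, y)`, `(x + 1, y)`
is decided by `P`, with outcome `σ`. -/
def EventualOrder (P : ℤ → ℤ → Prop) (x y : ℤ) (σ : Prop) : Prop :=
  ∀ᶠ N : ℕ in atTop, ∃ t < N + 1, ∃ a b r : ℤ, 0 ≤ r ∧ r < 2 ^ t ∧
    x + 2 ^ N + 1 = 2 ^ t * (2 * a + 1) ∧ y + 2 ^ N = 2 ^ t * b + r ∧ (P a b ↔ σ)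

lemma eventualOrder_of_eq {P : ℤ → ℤ → Prop} (hP : DyadicPeriodic P) {x y a b r : ℤ} {t : ℕ}
    (hr : 0 ≤ r) (hr' : r < 2 ^ t) (hx : x + 1 = 2 ^ t * (2 * a + 1)) (hy : y = 2 ^ t * b + r) :
    EventualOrder P x y (P a b) := by
  filter_upwards [eventually_ge_atTop (t + 2)] with N hN
  obtain ⟨s, rfl⟩ := Nat.exists_eq_add_of_le hN
  -- With `N = t + 2 + s`, adding `2 ^ N = 2 ^ t * (4 * 2 ^ s)` raises `a` by `2 * 2 ^ s` and `b` by
  -- `4 * 2 ^ s`.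
  refine ⟨t, by omega, a + 2 * 2 ^ s, b + 4 * 2 ^ s, r, hr, hr', ?_, ?_, hP _ _ _ _⟩
  · rw [pow_add, pow_add]
    linear_combination hx
  · rw [pow_add, pow_add]
    linear_combination hy

lemma eventually_lt_two_pow (x : ℤ) : ∀ᶠ N : ℕ in atTop, x < 2 ^ N :=
  (tendsto_pow_atTop_atTop_of_one_lt (by norm_num : (1 : ℤ) < 2)).eventually_gt_atTop x

/-- On the central line the separating level is `t = N` itself and grows with the stack. Still, `a =
0` always, and `b` only records the sign of `y`. -/
lemma eventualOrder_neg_one (P : ℤ → ℤ → Prop) (y : ℤ) :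
    EventualOrder P (-1) y (P 0 (if 0 ≤ y then 1 else 0)) := by
  filter_upwards [eventually_lt_two_pow y, eventually_lt_two_pow (-y)] with N h1 h2
  refine ⟨N, by omega, 0, if 0 ≤ y then 1 else 0, if 0 ≤ y then y else y + 2 ^ N, ?_, ?_, ?_, ?_,
    Iff.rfl⟩
  · split_ifs <;> linarith
  · split_ifs <;> linarith
  · ring
  · split_ifs <;> ring

lemma exists_two_pow_mul_odd {x : ℤ} (hx : x ≠ 0) : ∃ (t : ℕ) (a : ℤ), x = 2 ^ t * (2 * a + 1) := by
  have hf : FiniteMultiplicity 2 x := Int.finiteMultiplicity_iff.2 ⟨by decide, hx⟩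
  obtain ⟨m, hm, h⟩ := hf.exists_eq_pow_mul_and_not_dvd
  refine ⟨multiplicity 2 x, m / 2, ?_⟩
  rw [show 2 * (m / 2) + 1 = m by omega]
  exact hm

lemma exists_eventualOrder {P : ℤ → ℤ → Prop} (hP : DyadicPeriodic P) (x y : ℤ) :
    ∃ σ, EventualOrder P x y σ := by
  by_cases hx : x + 1 = 0
  · obtain rfl : x = -1 := by omega
    exact ⟨_, eventualOrder_neg_one P y⟩
  · obtain ⟨t, a, h⟩ := exists_two_pow_mul_odd hx
    exact ⟨_, eventualOrder_of_eq hP (Int.emod_nonneg y (by positivity))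
      (Int.emod_lt_of_pos y (by positivity)) h (Int.mul_ediv_add_emod y (2 ^ t)).symm⟩

lemma dirOf_add_two_pow (x y : ℤ) {N : ℕ} (hN : 1 ≤ N) :
    dirOf (x + 2 ^ N) (y + 2 ^ N) = dirOf x y := by
  obtain ⟨s, rfl⟩ := Nat.exists_eq_add_of_le hN
  rw [pow_add, pow_one]
  exact dirOf_add _ _ _ _

open Classical in
lemma eventually_view_fst (c : Fin 4 → Colour) {w z : ℤ} {σ : Prop}
    (h : EventualOrder TopFst w z σ) : ∀ᶠ n in atTop, view c n (w + z + 1, w - z) =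
      some (if σ then shown c 2 (w + 1) z else shown c 0 w z) := by
  -- The grid of side `2 ^ (N + 1)` has its middle at `2 ^ N`, hence the passage from `n` to `N +
  -- 1`.
  rw [← map_add_atTop_eq_nat 1, eventually_map]
  filter_upwards [h, eventually_ge_atTop 1, eventually_lt_two_pow (w + 1),
    eventually_lt_two_pow (-w), eventually_lt_two_pow z, eventually_lt_two_pow (-z)]
    with N ⟨t, ht, a, b, r, hr, hr', ha, hb, hσ⟩ hN h1 h2 h3 h4
  have e : (2 : ℤ) ^ (N + 1) = 2 ^ N + 2 ^ N := by ring
  have := view_fst c (n := N + 1) (by linarith) (by linarith) (by linarith) (by linarith) ht ha hb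
    hr hr'
  rw [show w + 2 ^ N + (z + 2 ^ N) + 1 - 2 ^ (N + 1) = w + z + 1 by rw [e]; ring,
    show w + 2 ^ N - (z + 2 ^ N) = w - z by ring,
    show w + 2 ^ N + 1 = w + 1 + 2 ^ N by ring] at this
  rw [this]
  simp only [shown, dirOf_add_two_pow _ _ hN, hσ]

open Classical in
lemma eventually_view_snd (c : Fin 4 → Colour) {w z : ℤ} {σ : Prop}
    (h : EventualOrder TopSnd z w σ) : ∀ᶠ n in atTop, view c n (w + z + 1, w - z - 1) =
      some (if σ then shown c 3 w (z + 1) else shown c 1 w z) := by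
  rw [← map_add_atTop_eq_nat 1, eventually_map]
  filter_upwards [h, eventually_ge_atTop 1, eventually_lt_two_pow w,
    eventually_lt_two_pow (-w), eventually_lt_two_pow (z + 1), eventually_lt_two_pow (-z)]
    with N ⟨t, ht, a, b, r, hr, hr', ha, hb, hσ⟩ hN h1 h2 h3 h4
  have e : (2 : ℤ) ^ (N + 1) = 2 ^ N + 2 ^ N := by ring
  have := view_snd c (n := N + 1) (by linarith) (by linarith) (by linarith) (by linarith) ht ha hb
    hr hr'
  rw [show w + 2 ^ N + (z + 2 ^ N) + 1 - 2 ^ (N + 1) = w + z + 1 by rw [e]; ring,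
    show w + 2 ^ N - (z + 2 ^ N) - 1 = w - z - 1 by ring,
    show z + 2 ^ N + 1 = z + 1 + 2 ^ N by ring] at this
  rw [this]
  simp only [shown, dirOf_add_two_pow _ _ hN, hσ]

lemma exists_eventually_view (c : Fin 4 → Colour) (K : ℤ × ℤ) :
    ∃ l, ∀ᶠ n in atTop, view c n K = some l := by
  obtain ⟨k, m⟩ := K
  rcases Int.emod_two_eq_zero_or_one (k + m) with h | h
  · obtain ⟨σ, hσ⟩ := exists_eventualOrder dyadicPeriodic_topSnd ((k - m - 2) / 2) ((k + m) / 2)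
    have := eventually_view_snd c hσ
    rw [show (k + m) / 2 + (k - m - 2) / 2 + 1 = k by omega,
      show (k + m) / 2 - (k - m - 2) / 2 - 1 = m by omega] at this
    exact ⟨_, this⟩
  · obtain ⟨σ, hσ⟩ := exists_eventualOrder dyadicPeriodic_topFst ((k + m - 1) / 2) ((k - m - 1) / 2)
    have := eventually_view_fst c hσ
    rw [show (k + m - 1) / 2 + (k - m - 1) / 2 + 1 = k by omega,
      show (k + m - 1) / 2 - (k - m - 1) / 2 = m by omega] at this
    exact ⟨_, this⟩

/-- The decoration of the unit square at `K` that is eventually seen. -/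
noncomputable def limitView (c : Fin 4 → Colour) (K : ℤ × ℤ) : Decoration :=
  (exists_eventually_view c K).choose

lemma eventually_view (c : Fin 4 → Colour) (K : ℤ × ℤ) :
    ∀ᶠ n in atTop, view c n K = some (limitView c K) :=
  (exists_eventually_view c K).choose_spec

lemma limitView_eq {c : Fin 4 → Colour} {K : ℤ × ℤ} {l : Decoration}
    (h : ∀ᶠ n in atTop, view c n K = some l) : limitView c K = l := by
  obtain ⟨n, h1, h2⟩ := ((eventually_view c K).and h).exists
  exact Option.some_injective _ (h1.symm.trans h2)

lemma limitView_fst (c : Fin 4 → Colour) {w z a b : ℤ} {t : ℕ}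
    (hw : w + 1 = 2 ^ t * (2 * a + 1)) (hz : z = 2 ^ t * b) :
    limitView c (w + z + 1, w - z) = if TopFst a b then shown c 2 (w + 1) z else shown c 0 w z := by
  apply limitView_eq
  have h : EventualOrder TopFst w z (TopFst a b) :=
    eventualOrder_of_eq dyadicPeriodic_topFst (r := 0) le_rfl (by positivity) hw (by linarith)
  convert eventually_view_fst c h

lemma limitView_fst_arrow (c : Fin 4 → Colour) (w z : ℤ) :
    limitView c (w + z + 1, w - z) = shown c 2 (w + 1) z ∨
      limitView c (w + z + 1, w - z) = shown c 0 w z := by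
  classical
  obtain ⟨σ, hσ⟩ := exists_eventualOrder dyadicPeriodic_topFst w z
  rw [limitView_eq (eventually_view_fst c hσ)]
  split_ifs <;> simp

lemma limitView_snd_arrow (c : Fin 4 → Colour) (w z : ℤ) :
    limitView c (w + z + 1, w - z - 1) = shown c 3 w (z + 1) ∨
      limitView c (w + z + 1, w - z - 1) = shown c 1 w z := by
  classical
  obtain ⟨σ, hσ⟩ := exists_eventualOrder dyadicPeriodic_topSnd z w
  rw [limitView_eq (eventually_view_snd c hσ)]
  split_ifs <;> simp

/-! ### Geometry of unit squares and the tiling property -/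

lemma mem_unitSquare {K : ℤ × ℤ} {p : Plane} : p ∈ unitSquare K ↔
    ((K.1 : ℝ) ≤ p 0 ∧ p 0 ≤ K.1 + 1) ∧ (K.2 : ℝ) ≤ p 1 ∧ p 1 ≤ K.2 + 1 := Iff.rfl

/-- The images of the lower left and upper right corners bound `t` from both sides. -/
lemma eq_of_translate_unitSquare {K K' : ℤ × ℤ} {t : Plane}
    (h : (fun p => p + t) '' unitSquare K = unitSquare K') :
    t 0 = K'.1 - K.1 ∧ t 1 = K'.2 - K.2 := by
  have h1 : !₂[(K.1 : ℝ), (K.2 : ℝ)] + t ∈ unitSquare K' :=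
    h ▸ Set.mem_image_of_mem _ (by simp [mem_unitSquare])
  have h2 : !₂[(K.1 : ℝ) + 1, (K.2 : ℝ) + 1] + t ∈ unitSquare K' :=
    h ▸ Set.mem_image_of_mem _ (by simp [mem_unitSquare])
  simp [mem_unitSquare] at h1 h2
  constructor <;> linarith

lemma unitSquare_injective : Function.Injective unitSquare := by
  intro K K' h
  have := eq_of_translate_unitSquare (K := K) (K' := K') (t := 0) (by simpa using h)
  simp only [PiLp.zero_apply] at this
  have h1 : (K.1 : ℝ) = K'.1 := by linarith
  have h2 : (K.2 : ℝ) = K'.2 := by linarith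
  exact Prod.ext (by exact_mod_cast h1) (by exact_mod_cast h2)

lemma unitSquare_eq_inter (K : ℤ × ℤ) : unitSquare K =
    (EuclideanSpace.proj 0 : Plane →L[ℝ] ℝ) ⁻¹' Set.Icc (K.1 : ℝ) (K.1 + 1) ∩
      (EuclideanSpace.proj 1 : Plane →L[ℝ] ℝ) ⁻¹' Set.Icc (K.2 : ℝ) (K.2 + 1) :=
  rfl

lemma isOpenMap_proj (i : Fin 2) :
    IsOpenMap (EuclideanSpace.proj i : Plane →L[ℝ] ℝ) :=
  ContinuousLinearMap.isOpenMap _ fun x => ⟨EuclideanSpace.single i x, by simp⟩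

lemma mem_interior_unitSquare {K : ℤ × ℤ} {p : Plane} : p ∈ interior (unitSquare K) ↔
    ((K.1 : ℝ) < p 0 ∧ p 0 < K.1 + 1) ∧ (K.2 : ℝ) < p 1 ∧ p 1 < K.2 + 1 := by
  rw [unitSquare_eq_inter, interior_inter,
    ← (isOpenMap_proj 0).preimage_interior_eq_interior_preimage (by fun_prop),
    ← (isOpenMap_proj 1).preimage_interior_eq_interior_preimage (by fun_prop),
    interior_Icc, interior_Icc]
  rfl

lemma norm_le_abs_add_abs (p : Plane) : ‖p‖ ≤ |p 0| + |p 1| := by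
  rw [EuclideanSpace.norm_eq, Fin.sum_univ_two]
  apply Real.sqrt_le_iff.2
  refine ⟨by positivity, ?_⟩
  simp only [Real.norm_eq_abs]
  nlinarith [abs_nonneg (p 0), abs_nonneg (p 1)]

lemma unitSquare_subset_ball {K : ℤ × ℤ} {p : Plane} {R : ℝ} (h0 : |K.1 - p 0| ≤ R)
    (h1 : |K.2 - p 1| ≤ R) : unitSquare K ⊆ Metric.ball p (2 * R + 3) := by
  intro q hq
  rw [mem_unitSquare] at hq
  rw [abs_le] at h0 h1
  rw [mem_ball_iff_norm]
  refine (norm_le_abs_add_abs _).trans_lt ?_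
  have a0 : |(q - p) 0| ≤ R + 1 := abs_le.2 ⟨by simp; linarith, by simp; linarith⟩
  have a1 : |(q - p) 1| ≤ R + 1 := abs_le.2 ⟨by simp; linarith, by simp; linarith⟩
  linarith

lemma isCompact_unitSquare (K : ℤ × ℤ) : IsCompact (unitSquare K) := by
  refine Metric.isCompact_of_isClosed_isBounded ?_ ?_
  · rw [unitSquare_eq_inter]
    exact (isClosed_Icc.preimage (by fun_prop)).inter (isClosed_Icc.preimage (by fun_prop))
  · exact Metric.isBounded_ball.subset (unitSquare_subset_ball (p := !₂[(K.1 : ℝ), (K.2 : ℝ)])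
      (R := 0) (by simp) (by simp))

lemma interior_unitSquare_nonempty (K : ℤ × ℤ) : (interior (unitSquare K)).Nonempty := by
  refine ⟨!₂[(K.1 : ℝ) + 1 / 2, (K.2 : ℝ) + 1 / 2], ?_⟩
  rw [mem_interior_unitSquare]
  norm_num

lemma eq_of_mem_interior_unitSquare {K K' : ℤ × ℤ} {p : Plane} (h : p ∈ interior (unitSquare K))
    (h' : p ∈ interior (unitSquare K')) : K = K' := by
  rw [mem_interior_unitSquare] at h h'
  have aux : ∀ {k m : ℤ} {x : ℝ}, (k : ℝ) < x → x < k + 1 → (m : ℝ) < x → x < m + 1 → k = m := by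
    intro k m x h1 h2 h3 h4
    have e1 : (k : ℝ) < ((m + 1 : ℤ) : ℝ) := by push_cast; linarith
    have e2 : (m : ℝ) < ((k + 1 : ℤ) : ℝ) := by push_cast; linarith
    have e3 := Int.cast_lt.1 e1
    have e4 := Int.cast_lt.1 e2
    omega
  exact Prod.ext (aux h.1.1 h.1.2 h'.1.1 h'.1.2) (aux h.2.1 h.2.2 h'.2.1 h'.2.2)

lemma mem_arrowedTiling {c : Fin 4 → Colour} {Q : Tile Decoration} :
    Q ∈ arrowedTiling c ↔ ∃ K, Q = ⟨unitSquare K, limitView c K⟩ := by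
  constructor
  · intro h
    have h : ∀ᶠ n in atTop, Q ∈ patch c n := h
    obtain ⟨n, K, l, -, rfl⟩ := h.exists
    obtain ⟨m, ⟨K', l', hv, he⟩, hm⟩ := (h.and (eventually_view c K)).exists
    rw [Tile.mk.injEq] at he
    obtain rfl := unitSquare_injective he.1
    rw [hm, Option.some.injEq] at hv
    exact ⟨K, by rw [hv, he.2]⟩
  · rintro ⟨K, rfl⟩
    exact (eventually_view c K).mono fun n hn => ⟨K, _, hn, rfl⟩

lemma isTiling_arrowedTiling (c : Fin 4 → Colour) : IsTiling (arrowedTiling c) where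
  compact Q hQ := by
    obtain ⟨K, rfl⟩ := mem_arrowedTiling.1 hQ
    exact isCompact_unitSquare K
  interior_nonempty Q hQ := by
    obtain ⟨K, rfl⟩ := mem_arrowedTiling.1 hQ
    exact interior_unitSquare_nonempty K
  covering := by
    refine Set.eq_univ_of_forall fun p => Set.mem_iUnion₂.2
      ⟨_, mem_arrowedTiling.2 ⟨(⌊p 0⌋, ⌊p 1⌋), rfl⟩, ?_⟩
    exact ⟨⟨Int.floor_le _, (Int.lt_floor_add_one _).le⟩,
      Int.floor_le _, (Int.lt_floor_add_one _).le⟩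
  packing Q hQ Q' hQ' hne := by
    obtain ⟨K, rfl⟩ := mem_arrowedTiling.1 hQ
    obtain ⟨K', rfl⟩ := mem_arrowedTiling.1 hQ'
    refine Set.eq_empty_of_forall_notMem fun p hp => hne ?_
    rw [eq_of_mem_interior_unitSquare hp.1 hp.2]

/-! ### Refuting periods throughout the hull -/

section General

variable {L : Type}

lemma translateAll_zero (T : Set (Tile L)) : translateAll 0 T = T := by
  have : Tile.translate (L := L) 0 = id := by
    funext Q
    simp [Tile.translate]
  simp [translateAll, this]

lemma Tile.translate_translate (s t : Plane) (Q : Tile L) :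
    (Q.translate s).translate t = Q.translate (s + t) := by
  simp only [Tile.translate, Set.image_image, add_assoc]

lemma mem_translateAll {t : Plane} {T : Set (Tile L)} {Q : Tile L} :
    Q ∈ translateAll t T ↔ Q.translate (-t) ∈ T := by
  constructor
  · rintro ⟨Q, hQ, rfl⟩
    rw [Tile.translate_translate, add_neg_cancel]
    simpa [Tile.translate] using hQ
  · intro h
    refine ⟨_, h, ?_⟩
    rw [Tile.translate_translate, neg_add_cancel]
    simp [Tile.translate]

lemma translate_mem_translateAll {t : Plane} {T : Set (Tile L)} {Q : Tile L} :
    Q.translate t ∈ translateAll t T ↔ Q ∈ T := by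
  rw [mem_translateAll, Tile.translate_translate, add_neg_cancel]
  simp [Tile.translate]

lemma Tile.translate_support_subset_ball {Q : Tile L} {p : Plane} {r : ℝ}
    (h : Q.support ⊆ Metric.ball p r) (t : Plane) :
    (Q.translate t).support ⊆ Metric.ball (p + t) r := by
  rintro _ ⟨q, hq, rfl⟩
  simpa [Metric.mem_ball] using h hq

/-- Every ball of some fixed radius contains a tile that shows that `t` is not a period. -/
def UniformlyRefutes (T : Set (Tile L)) (t : Plane) : Prop :=
  ∃ r : ℝ, ∀ p : Plane, ∃ Q ∈ T, Q.support ⊆ Metric.ball p r ∧ Q.translate t ∉ T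

lemma UniformlyRefutes.not_isPeriod {T : Set (Tile L)} {t : Plane} (h : UniformlyRefutes T t) :
    ¬ IsPeriod T t := by
  obtain ⟨r, h⟩ := h
  obtain ⟨Q, hQ, -, hn⟩ := h 0
  intro hp
  exact hn (hp ▸ translate_mem_translateAll.2 hQ)

lemma exists_agree_of_mem_hull {S T : Set (Tile L)} (h : S ∈ hull T) {R : ℝ} (hR : 1 ≤ R) :
    ∃ x t : Plane, ‖x‖ < 1 ∧
      ∀ Q : Tile L, Q.support ⊆ Metric.ball 0 R → (Q ∈ translateAll x S ↔ Q ∈ translateAll t T) := by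
  have hR0 : 0 < R := by linarith
  have hs : 0 < 1 / Real.sqrt 2 := by positivity
  -- Staying below `1 / √2` rules out the cap in `tilingDist`; staying below `1 / R` makes the ball
  -- of agreement contain `B_R`.
  obtain ⟨t, ht⟩ := h.2 (ENNReal.ofReal (min (1 / R) (1 / Real.sqrt 2)))
    (ENNReal.ofReal_pos.2 (by positivity))
  rw [tilingDist, min_lt_iff] at ht
  have ht := ht.resolve_right (not_lt.2 (ENNReal.ofReal_le_ofReal (min_le_right _ _)))
  have ht := ht.trans_le (ENNReal.ofReal_le_ofReal (min_le_left _ _))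
  simp only [preDist, iInf_lt_iff] at ht
  obtain ⟨ε, ⟨hε, x, hx, y, hy, he⟩, hlt⟩ := ht
  rw [ENNReal.ofReal_lt_ofReal_iff (by positivity)] at hlt
  have hε1 : ε < 1 := hlt.trans_le (by rw [div_le_one hR0]; exact hR)
  have hRε : R ≤ 1 / ε := by
    rw [le_div_iff₀ hε, mul_comm, ← le_div_iff₀ hR0]
    exact hlt.le
  refine ⟨x, t + y, (mem_ball_zero_iff.1 hx).trans hε1, fun Q hQ => ?_⟩
  have hQ' := hQ.trans (Metric.ball_subset_ball hRε)
  have := Set.ext_iff.1 he Q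
  simp only [inBall, Set.mem_ofPred_eq, hQ', and_true] at this
  rw [this, mem_translateAll, mem_translateAll, mem_translateAll, Tile.translate_translate]
  rw [neg_add_rev]

/-- Near any point, `S` agrees with a translate of `T` up to a small shift. The witness in `T` and
its translate by `t` lie in a bounded region, so both can be carried over with the same radius `r`.
-/
lemma UniformlyRefutes.of_mem_hull {S T : Set (Tile L)} {t : Plane} (h : UniformlyRefutes T t)
    (hS : S ∈ hull T) : UniformlyRefutes S t := by
  obtain ⟨r, h⟩ := h
  refine ⟨r, fun p => ?_⟩
  -- This ball about `0` contains the balls of radius `r` about `p + x` and `p + x + t`, since `‖x‖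
  -- < 1`.
  obtain ⟨x, s, hx, hxs⟩ := exists_agree_of_mem_hull hS (R := ‖p‖ + |r| + ‖t‖ + 1)
    (by linarith [norm_nonneg p, abs_nonneg r, norm_nonneg t])
  obtain ⟨Q, hQ, hr, hn⟩ := h (p + x - s)
  have h1 : (Q.translate s).support ⊆ Metric.ball (p + x) r := by
    simpa using Tile.translate_support_subset_ball hr s
  have h2 : ((Q.translate s).translate t).support ⊆ Metric.ball (p + x + t) r :=
    Tile.translate_support_subset_ball h1 t
  have hpx := norm_add_le p x
  have hpxt := norm_add_le (p + x) t
  have hrr := le_abs_self r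
  have m1 := (hxs (Q.translate s) (h1.trans (Metric.ball_subset_ball' (by
    rw [dist_zero_right]; linarith [norm_nonneg t])))).2 (translate_mem_translateAll.2 hQ)
  have m2 := hxs ((Q.translate s).translate t) (h2.trans (Metric.ball_subset_ball' (by
    rw [dist_zero_right]; linarith)))
  rw [mem_translateAll] at m1
  refine ⟨_, m1, ?_, fun hc => hn ?_⟩
  · simpa using Tile.translate_support_subset_ball h1 (-x)
  · rw [Tile.translate_translate, add_comm (-x) t, ← Tile.translate_translate,
      ← mem_translateAll, m2, Tile.translate_translate, add_comm s t, ← Tile.translate_translate,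
      translate_mem_translateAll] at hc
    exact hc

lemma isNonperiodic_of_uniformlyRefutes {T : Set (Tile L)}
    (h : ∀ t : Plane, t ≠ 0 → UniformlyRefutes T t) : IsNonperiodic T :=
  fun t ht => by_contra fun hne => (h t hne).not_isPeriod ht

lemma isAperiodic_of_uniformlyRefutes {T : Set (Tile L)}
    (h : ∀ t : Plane, t ≠ 0 → UniformlyRefutes T t) : IsAperiodic T :=
  fun _ hS ⟨t, hne, ht⟩ => ((h t hne).of_mem_hull hS).not_isPeriod ht

lemma tendsto_tilingDist_zero {T : ℕ → Set (Tile L)} {S : Set (Tile L)}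
    (h : ∀ r : ℝ, ∀ᶠ n in atTop, inBall r (T n) = inBall r S) :
    Tendsto (fun n => tilingDist (T n) S) atTop (𝓝 0) := by
  rw [ENNReal.tendsto_nhds_zero]
  intro δ hδ
  obtain ⟨ε, hε, hεδ⟩ := ENNReal.lt_iff_exists_nnreal_btwn.1 hδ
  have hε : (0 : ℝ) < ε := by exact_mod_cast hε
  filter_upwards [h (1 / ε)] with n hn
  refine (min_le_left _ _).trans ((iInf₂_le (ε : ℝ) ?_).trans ?_)
  · refine ⟨hε, 0, Metric.mem_ball_self hε, 0, Metric.mem_ball_self hε, ?_⟩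
    simpa only [translateAll_zero] using hn
  · rw [ENNReal.ofReal_coe_nnreal]
    exact hεδ.le

end General

/-! ### Convergence of the patches -/

lemma finite_unitSquare_subset_ball (r : ℝ) :
    {K : ℤ × ℤ | unitSquare K ⊆ Metric.ball (0 : Plane) r}.Finite := by
  refine ((Set.finite_Icc (-⌈r⌉) ⌈r⌉).prod (Set.finite_Icc (-⌈r⌉) ⌈r⌉)).subset fun K hK => ?_
  have h := hK (show !₂[(K.1 : ℝ), (K.2 : ℝ)] ∈ unitSquare K by simp [mem_unitSquare])
  rw [mem_ball_zero_iff] at h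
  have h0 := (PiLp.norm_apply_le _ (0 : Fin 2)).trans (h.le.trans (Int.le_ceil r))
  have h1 := (PiLp.norm_apply_le _ (1 : Fin 2)).trans (h.le.trans (Int.le_ceil r))
  simp only [Real.norm_eq_abs, Matrix.cons_val_zero, Matrix.cons_val_one] at h0 h1
  rw [abs_le] at h0 h1
  exact ⟨⟨by exact_mod_cast h0.1, by exact_mod_cast h0.2⟩,
    by exact_mod_cast h1.1, by exact_mod_cast h1.2⟩

lemma eventually_inBall_patch (c : Fin 4 → Colour) (r : ℝ) :
    ∀ᶠ n in atTop, inBall r (patch c n) = inBall r (arrowedTiling c) := by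
  have := (finite_unitSquare_subset_ball r).eventually_all.2 fun K _ => eventually_view c K
  filter_upwards [this] with n hn
  ext Q
  constructor
  · rintro ⟨⟨K, l, hv, rfl⟩, hQ⟩
    refine ⟨mem_arrowedTiling.2 ⟨K, ?_⟩, hQ⟩
    rw [hn K hQ, Option.some.injEq] at hv
    rw [hv]
  · rintro ⟨hA, hQ⟩
    obtain ⟨K, rfl⟩ := mem_arrowedTiling.1 hA
    exact ⟨⟨K, _, hn K hQ, rfl⟩, hQ⟩

/-! ### No nonzero vector is a period -/

lemma exists_floor_near (x0 M : ℤ) (hM : 0 < M) (x : ℝ) :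
    ∃ m : ℤ, |((x0 + M * m : ℤ) : ℝ) - x| ≤ |(x0 : ℝ)| + M := by
  have hM : (0 : ℝ) < M := by exact_mod_cast hM
  refine ⟨⌊x / M⌋, ?_⟩
  have h1 := Int.floor_le (x / M)
  have h2 := Int.lt_floor_add_one (x / M)
  rw [le_div_iff₀ hM] at h1
  rw [div_lt_iff₀ hM] at h2
  push_cast
  have h3 := abs_le.1 (le_refl |(x0 : ℝ)|)
  exact abs_le.2 ⟨by nlinarith, by nlinarith⟩

/-- A residue class of indices modulo `M` is relatively dense. Up to a bounded error, the indices of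
a point are half the sum and half the difference of its coordinates. -/
lemma exists_unitSquare_subset_ball (w z M : ℤ) (hM : 0 < M) : ∃ r : ℝ, ∀ p : Plane, ∃ m n : ℤ,
    unitSquare (w + M * m + (z + M * n) + 1, w + M * m - (z + M * n)) ⊆ Metric.ball p r := by
  refine ⟨2 * (|(w : ℝ)| + |(z : ℝ)| + 2 * M + 1) + 3, fun p => ?_⟩
  obtain ⟨m, hm⟩ := exists_floor_near w M hM ((p 0 + p 1) / 2)
  obtain ⟨n, hn⟩ := exists_floor_near z M hM ((p 0 - p 1) / 2)
  refine ⟨m, n, unitSquare_subset_ball ?_ ?_⟩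
  all_goals
    rw [abs_le] at hm hn ⊢
    push_cast at hm hn ⊢
    constructor <;> linarith

lemma uniformlyRefutes_of_not_int (c : Fin 4 → Colour) {t : Plane}
    (h : ¬ ∃ α β : ℤ, t 0 = α ∧ t 1 = β) : UniformlyRefutes (arrowedTiling c) t := by
  obtain ⟨r, hr⟩ := exists_unitSquare_subset_ball 0 0 1 one_pos
  refine ⟨r, fun p => ?_⟩
  obtain ⟨m, n, hmn⟩ := hr p
  refine ⟨_, mem_arrowedTiling.2 ⟨_, rfl⟩, hmn, fun hA => h ?_⟩
  obtain ⟨K', hK'⟩ := mem_arrowedTiling.1 hA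
  have := eq_of_translate_unitSquare (congrArg Tile.support hK')
  exact ⟨_, _, by rw [this.1, ← Int.cast_sub], by rw [this.2, ← Int.cast_sub]⟩

lemma uniformlyRefutes_of_limitView_ne (c : Fin 4 → Colour) {t : Plane} {α β : ℤ} (h0 : t 0 = α)
    (h1 : t 1 = β) {w z M : ℤ} (hM : 0 < M)
    (h : ∀ m n : ℤ, limitView c (w + M * m + (z + M * n) + 1, w + M * m - (z + M * n)) ≠
      limitView c (w + M * m + (z + M * n) + 1 + α, w + M * m - (z + M * n) + β)) :
    UniformlyRefutes (arrowedTiling c) t := by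
  obtain ⟨r, hr⟩ := exists_unitSquare_subset_ball w z M hM
  refine ⟨r, fun p => ?_⟩
  obtain ⟨m, n, hmn⟩ := hr p
  refine ⟨_, mem_arrowedTiling.2 ⟨_, rfl⟩, hmn, fun hA => h m n ?_⟩
  obtain ⟨⟨k, l⟩, hK'⟩ := mem_arrowedTiling.1 hA
  have h2 := eq_of_translate_unitSquare (congrArg Tile.support hK')
  rw [h0, h1, ← Int.cast_sub, ← Int.cast_sub, Int.cast_inj, Int.cast_inj] at h2
  have h3 : limitView c _ = limitView c (k, l) := congrArg Tile.label hK'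
  rw [h3]
  dsimp only at h2
  congr 1
  ext
  · dsimp only; linarith
  · dsimp only; linarith

/-- `TopFst` is true for `b ≡ 1`, false for `b ≡ 2`, and the parity of `a` for `b ≡ 0, 3` modulo 4.
Each witness compares two of these behaviours. -/
lemma exists_topFst_ne {δ ε : ℤ} (h : ¬ (δ % 2 = 0 ∧ ε % 2 = 0)) :
    ∃ a b : ℤ, ¬ (TopFst (a + δ) (b + 2 * ε) ↔ TopFst a b) := by
  unfold TopFst
  by_cases h1 : ε % 2 = 0
  · exact ⟨0, 0, by omega⟩
  · by_cases h2 : δ % 2 = 0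
    · exact ⟨0, 1, by omega⟩
    · exact ⟨0, 2, by omega⟩

/-- After division by the gcd the entries are coprime, hence not both even. Restoring the odd part
of the gcd does not change that. -/
lemma exists_two_pow_mul_not_even {δ ε : ℤ} (h : ¬ (δ = 0 ∧ ε = 0)) :
    ∃ (k : ℕ) (δ' ε' : ℤ), δ = 2 ^ k * δ' ∧ ε = 2 ^ k * ε' ∧ ¬ (δ' % 2 = 0 ∧ ε' % 2 = 0) := by
  have hg : Int.gcd δ ε ≠ 0 := by rwa [Ne, Int.gcd_eq_zero_iff]
  obtain ⟨δ', ε', hco, hδ, hε⟩ := Int.exists_gcd_one (Nat.pos_of_ne_zero hg)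
  obtain ⟨k, a, ha⟩ := exists_two_pow_mul_odd (x := (Int.gcd δ ε : ℤ)) (by exact_mod_cast hg)
  refine ⟨k, (2 * a + 1) * δ', (2 * a + 1) * ε', ?_, ?_, ?_⟩
  · rw [← mul_assoc, ← ha, mul_comm]; exact hδ
  · rw [← mul_assoc, ← ha, mul_comm]; exact hε
  · rintro ⟨h1, h2⟩
    rw [Int.mul_emod] at h1 h2
    have ho : (2 * a + 1) % 2 = 1 := by omega
    rw [ho] at h1 h2
    have d1 : (2 : ℤ) ∣ δ' := by omega
    have d2 : (2 : ℤ) ∣ ε' := by omega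
    have := Int.dvd_coe_gcd d1 d2
    rw [hco] at this
    omega

/-- Such a vector exchanges overlaps of neighbours in the first index with overlaps in the second.
The former carry arrows 0 or 2, the latter 1 or 3. -/
lemma limitView_ne_of_odd (c : Fin 4 → Colour) (w z α β : ℤ) (h : (α + β) % 2 = 1) :
    limitView c (w + z + 1, w - z) ≠ limitView c (w + z + 1 + α, w - z + β) := by
  have e1 : w + z + 1 + α = (w + (α + β + 1) / 2) + (z + (α - β - 1) / 2) + 1 := by omega
  have e2 : w - z + β = (w + (α + β + 1) / 2) - (z + (α - β - 1) / 2) - 1 := by omega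
  rw [e1, e2]
  rcases limitView_fst_arrow c w z with h1 | h1 <;>
    rcases limitView_snd_arrow c (w + (α + β + 1) / 2) (z + (α - β - 1) / 2) with h2 | h2 <;>
    rw [h1, h2] <;> simp [shown]

lemma dirOf_eq_dirOf {i j k l : ℤ} (h : dirOf i j = dirOf k l) :
    i % 2 = k % 2 ∧ j % 2 = l % 2 := by
  unfold dirOf at h
  split_ifs at h <;> simp at h <;> omega

/-- Equal arrows mean that the visible large squares differ by exactly `(δ, ε)`. As `c` is
injective, equal colours then force equal index parities. -/
lemma limitView_ne_of_not_even {c : Fin 4 → Colour} (hc : Function.Injective c) (w z δ ε : ℤ)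
    (h : ¬ (δ % 2 = 0 ∧ ε % 2 = 0)) :
    limitView c (w + z + 1, w - z) ≠ limitView c (w + δ + (z + ε) + 1, w + δ - (z + ε)) := by
  intro he
  rcases limitView_fst_arrow c w z with h1 | h1 <;>
    rcases limitView_fst_arrow c (w + δ) (z + ε) with h2 | h2 <;>
    rw [h1, h2] at he <;> simp [shown, hc.eq_iff] at he <;>
    · have := dirOf_eq_dirOf he
      omega

lemma uniformlyRefutes_arrowedTiling {c : Fin 4 → Colour} (hc : Function.Injective c) {t : Plane}
    (ht : t ≠ 0) : UniformlyRefutes (arrowedTiling c) t := by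
  by_cases hint : ∃ α β : ℤ, t 0 = α ∧ t 1 = β
  swap
  · exact uniformlyRefutes_of_not_int c hint
  obtain ⟨α, β, h0, h1⟩ := hint
  rcases Int.emod_two_eq_zero_or_one (α + β) with hpar | hpar
  swap
  · exact uniformlyRefutes_of_limitView_ne c h0 h1 (w := 0) (z := 0) one_pos
      fun m n => limitView_ne_of_odd c _ _ _ _ hpar
  obtain ⟨δ, ε, rfl, rfl⟩ : ∃ δ ε, α = δ + ε ∧ β = δ - ε :=
    ⟨(α + β) / 2, (α - β) / 2, by omega, by omega⟩
  have hne : ¬ (δ = 0 ∧ ε = 0) := by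
    rintro ⟨rfl, rfl⟩
    apply ht
    ext i
    fin_cases i
    · simpa using h0
    · simpa using h1
  obtain ⟨k, δ', ε', rfl, rfl, hodd⟩ := exists_two_pow_mul_not_even hne
  rcases k with _ | s
  · refine uniformlyRefutes_of_limitView_ne c h0 h1 (w := 0) (z := 0) one_pos fun m n => ?_
    convert limitView_ne_of_not_even hc (0 + 1 * m) (0 + 1 * n) δ' ε' hodd using 3 <;> ring
  · obtain ⟨a, b, hab⟩ := exists_topFst_ne hodd
    -- These indices are separated at level `s` with parameters `a`, `b`. The vector adds `(δ', 2 *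
    -- ε')` to the parameters, while steps of `M = 2 ^ (s + 2)` add `2 * m` and `4 * n`, which
    -- `TopFst` ignores.
    refine uniformlyRefutes_of_limitView_ne c h0 h1 (w := 2 ^ s * (2 * a + 1) - 1)
      (z := 2 ^ s * b) (M := 2 ^ (s + 2)) (by positivity) fun m n => ?_
    have e1 := limitView_fst c (w := 2 ^ s * (2 * a + 1) - 1 + 2 ^ (s + 2) * m)
      (z := 2 ^ s * b + 2 ^ (s + 2) * n) (a := a + 2 * m) (b := b + 4 * n) (t := s)
      (by ring) (by ring)
    have e2 := limitView_fst c
      (w := 2 ^ s * (2 * a + 1) - 1 + 2 ^ (s + 2) * m + 2 ^ (s + 1) * δ')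
      (z := 2 ^ s * b + 2 ^ (s + 2) * n + 2 ^ (s + 1) * ε')
      (a := a + δ' + 2 * m) (b := b + 2 * ε' + 4 * n) (t := s)
      (by ring) (by ring)
    simp only [dyadicPeriodic_topFst _ _ _ _] at e1 e2
    rw [e1]
    intro he
    rw [show ∀ x y : ℤ, x + y + 1 + (2 ^ (s + 1) * δ' + 2 ^ (s + 1) * ε') =
        x + 2 ^ (s + 1) * δ' + (y + 2 ^ (s + 1) * ε') + 1 by intros; ring,
      show ∀ x y : ℤ, x - y + (2 ^ (s + 1) * δ' - 2 ^ (s + 1) * ε') =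
        x + 2 ^ (s + 1) * δ' - (y + 2 ^ (s + 1) * ε') by intros; ring, e2] at he
    split_ifs at he <;> simp [shown] at he <;> tauto

end InductiveRotation

open InductiveRotation
theorem theorem3p4 (c : Fin 4 → Colour) (hc : Function.Injective c) :
    (IsTiling (arrowedTiling c) ∧
      Tendsto (fun n => tilingDist (patch c n) (arrowedTiling c)) atTop (𝓝 0)) ∧
    (∀ T ∈ hull (arrowedTiling c), IsAperiodic T ∧ IsNonperiodic T) ∧
    IsAperiodic (arrowedTiling c) ∧ IsNonperiodic (arrowedTiling c) := by
  have h := fun t => uniformlyRefutes_arrowedTiling hc (t := t)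
  exact ⟨⟨isTiling_arrowedTiling c, tendsto_tilingDist_zero (eventually_inBall_patch c)⟩,
    fun T hT => ⟨isAperiodic_of_uniformlyRefutes fun t ht => (h t ht).of_mem_hull hT,
      isNonperiodic_of_uniformlyRefutes fun t ht => (h t ht).of_mem_hull hT⟩,
    isAperiodic_of_uniformlyRefutes h, isNonperiodic_of_uniformlyRefutes h⟩
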